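/- Let $M$ be a closed connected surface (orientable or not) with $\chi(M)<0$, cut into finitely many triangles whose sides are glued in pairs, no side being glued to itself (for instance, any cell decomposition of $M$ that lifts to a triangulation of the universal cover). Let $E$ and $F$ be the sets of edges and of triangles. Each triangle has three angle slots; write $\mathbf R^{3F}$ for the space of assignments $x$ of a real number to each slot. For a vertex $v$ let $p^v(x)$ be the sum of the values in the slots at $v$, and for a triangle $t$ let $k^t(x)$ be the sum of its three values minus $\pi$. Put $$\mathbf N=\{x\in\mathbf R^{3F} : p^v(x)=2\pi \text{ for all } v,\ k^t(x)<0 \text{ for all } t,\ \text{all values of } x \text{ lie in } (0,\pi)\}.$$ For a side of a triangle $t$ lying on an edge $e$, let $\psi^e_t(x)=\frac{B+C-A}{2}$, where $A$ is the value in the slot of $t$ opposite to this side and $B,C$ are the values in the other two slots. Let $\psi^e$ be the sum of $\psi^e_t$ over the two triangle sides lying on $e$, and let $\Psi:\mathbf R^{3F}\to\mathbf R^E$ be the linear map $\Psi(x)=(\psi^e(x))_{e\in E}$. For $p\in\mathbf R^E$ write $\theta^e(p)=\pi-p^e$. A snake $\{e_i\}_{i=0}^n$ is a sequence of edges, with triangles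 $t_{-1},t_0,\dots,t_n$, that crosses $e_i$ from $t_{i-1}$ into $t_i$ and leaves each $t_i$ ($0\le i<n$) through one of the two sides other than the one through which it entered. A loop is a snake with $n\ge1$ which ends with the same crossing with which it starts: $e_n=e_0$ and $t_n=t_0$, entered through the same side. A snake is embedded if $e_0,\dots,e_n$ are distinct; a loop is embedded if $e_0,\dots,e_{n-1}$ are distinct. A snake doubles back on itself if for some nonempty stretch $e_m,\dots,e_q$ of it a later, disjoint stretch runs through the same edges backwards, that is, for some $r$ with $r-q>q$ the crossing number $r-i$ is the crossing of $e_i$ in the opposite direction for $m\le i\le q$ (for a loop both stretches are taken within $e_0,\dots,e_{n-1}$). A barbell is a loop that doubles back on itself such that the edges $e_i$ with $0\le i<n$, $i\notin[m,q]$, are distinct. A balloon is a snake with $e_n=e_0$ that doubles back on itself such that the edges $e_i$ with $0\le i\le n$, $i\notin[m,q]$, are distinct. Let $N$ be the set of all $p\in(-\pi,\pi)^E$ such that - $(n_1)$ for every vertex $v$, $\sum_{e\in v}p^e=2\pi$, where an edge with both endpoints at $v$ is counted twice; - $(n_2)$ for every nonempty set $S$ of triangles, $\sum_{e\in S}\theta^e(p)>\pi|S|$,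 where the sum is over the set of edges of the triangles in $S$; - $(n_3)$ $\sum_{i=0}^{n-1}\theta^{e_i}(p)<n\pi$ for every embedded loop and every barbell $\{e_i\}_{i=0}^n$; - $(n_4)$ $\sum_{i=0}^{n}\theta^{e_i}(p)<(n+2)\pi$ for every embedded snake and every balloon $\{e_i\}_{i=0}^n$. Then $\Psi(\mathbf N)=N$. -/

import Mathlib

open Real

noncomputable section

/-- A closed surface cut into triangles, given combinatorially. The corners of each triangle `t`
are labelled by `Fin 3`, and side `i` of `t` is the side opposite to corner `i`. Side `i` of `t` is
glued to a side of the triangle `nbr t i`; for `j ≠ i` the gluing takes corner `j` of `t` to corner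
`perm t i j` of `nbr t i`, and by convention `perm t i i` is the corner of `nbr t i` opposite to the
common side. Every side is glued to exactly one other side, so that the surface has no boundary.
The surface may be orientable or not, and a triangle may be glued to itself along two of its sides;
every triangular decomposition of a closed surface is of this form. -/
structure TriangleGluing (T : Type*) where
  nbr : T → Fin 3 → T
  perm : T → Fin 3 → Equiv.Perm (Fin 3)
  nbr_nbr : ∀ t i, nbr (nbr t i) (perm t i i) = t
  perm_perm : ∀ t i, perm (nbr t i) (perm t i i) = (perm t i)⁻¹
  no_fold : ∀ t i, (nbr t i, perm t i i) ≠ (t, i)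

namespace TriangleGluing

variable {T : Type*} (K : TriangleGluing T)

/-- The side glued to a given side. A pair `(t, i) : T × Fin 3` denotes a side of `t`, or the
corner of `t` opposite to it, which is also the slot of an angle of `t`. -/
def glue (d : T × Fin 3) : T × Fin 3 := (K.nbr d.1 d.2, K.perm d.1 d.2 d.2)

/-- The edges of the decomposition: sides up to gluing. -/
def Edge : Type _ := Quot (fun d d' : T × Fin 3 => d' = K.glue d)

/-- The edge on which a side lies. -/
def edge (d : T × Fin 3) : K.Edge := Quot.mk _ d

/-- One gluing of corners: corner `j` of `t` is glued to a corner of `K.nbr t i`, for `j ≠ i`. -/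
def CornerRel (c c' : T × Fin 3) : Prop :=
  ∃ i : Fin 3, i ≠ c.2 ∧ c' = (K.nbr c.1 i, K.perm c.1 i c.2)

/-- The vertices of the decomposition: corners up to gluing. -/
def Vertex : Type _ := Quot K.CornerRel

/-- The vertex at which a corner lies. -/
def vertex (c : T × Fin 3) : K.Vertex := Quot.mk _ c

instance [Finite T] : Finite K.Edge := Quot.finite _

instance [Finite T] : Finite K.Vertex := Quot.finite _

instance [Finite T] : Fintype K.Edge := Fintype.ofFinite _

/-- The underlying surface is connected. -/
def Connected : Prop :=
  ∀ t t' : T, Relation.ReflTransGen (fun a b => ∃ i, K.nbr a i = b) t t'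

/-- The Euler characteristic of the underlying surface. -/
def eulerChar : ℤ := (Nat.card K.Vertex : ℤ) - Nat.card K.Edge + Nat.card T

/-! ### Angle systems -/

open Classical in
/-- `p^v(x)`: the sum of the angles at the vertex `v`. -/
def angleSum [Fintype T] (v : K.Vertex) (x : T × Fin 3 → ℝ) : ℝ :=
  ∑ c : T × Fin 3 with K.vertex c = v, x c

/-- `k^t(x)`: the curvature of the triangle `t`. -/
def curvature (t : T) (x : T × Fin 3 → ℝ) : ℝ := (∑ i : Fin 3, x (t, i)) - π

/-- The set `𝐍` of negative-curvature angle systems. -/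
def angleSystems [Fintype T] : Set (T × Fin 3 → ℝ) :=
  {x | (∀ v : K.Vertex, K.angleSum v x = 2 * π) ∧ (∀ t : T, curvature t x < 0) ∧
    ∀ c : T × Fin 3, x c ∈ Set.Ioo 0 π}

/-- `ψ^e_t(x) = (B + C - A) / 2` for the side `d` of `t` on the edge `e`, where `A` is the angle
of `t` opposite to this side and `B`, `C` are the two angles of `t` along it. -/
def sideDefect (d : T × Fin 3) : (T × Fin 3 → ℝ) →ₗ[ℝ] ℝ :=
  (1 / 2 : ℝ) • ((LinearMap.proj (d.1, d.2 + 1) : (T × Fin 3 → ℝ) →ₗ[ℝ] ℝ) +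
    LinearMap.proj (d.1, d.2 + 2) - LinearMap.proj d)

open Classical in
/-- The linear map `Ψ`, whose component `ψ^e` at an edge `e` is the sum of the covectors `ψ^e_t`
over the two sides that lie on `e`. -/
def Psi [Fintype T] : (T × Fin 3 → ℝ) →ₗ[ℝ] (K.Edge → ℝ) :=
  LinearMap.pi fun e => ∑ d : T × Fin 3 with K.edge d = e, sideDefect d

/-! ### Snakes, loops, barbells and balloons -/

/-- A snake with edges `e_0, …, e_n`, running through triangles `t_{-1}, t_0, …, t_n`. Here `s i` is
the side of `t_i` through which the snake enters `t_i`, so that `e_i = K.edge (s i)`,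
`t_i = (s i).1`, and `K.glue (s i)` is the side through which it leaves `t_{i-1}`. The snake leaves
each `t_i` through one of the two sides other than the one through which it came in. The values
`s i` with `i > n` play no role. -/
def IsSnake (n : ℕ) (s : ℕ → T × Fin 3) : Prop :=
  ∀ i < n, (K.glue (s (i + 1))).1 = (s i).1 ∧ K.glue (s (i + 1)) ≠ s i

/-- A loop: a snake which ends by crossing its first edge again into its first triangle. -/
def IsLoop (n : ℕ) (s : ℕ → T × Fin 3) : Prop :=
  K.IsSnake n s ∧ 0 < n ∧ s n = s 0

/-- The edges `e_i` with `i ∈ I` are pairwise distinct. -/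
def EmbeddedOn (I : Set ℕ) (s : ℕ → T × Fin 3) : Prop :=
  Set.InjOn (fun i => K.edge (s i)) I

/-- Among the edges `e_0, …, e_{N-1}`, the stretch `e_m, …, e_q` is later run through backwards:
`e_m, …, e_q` are the same edges as `e_{r-m}, …, e_{r-q}`, crossed in the opposite direction, and the
two stretches are disjoint. -/
def DoublesBack (N : ℕ) (s : ℕ → T × Fin 3) (m q r : ℕ) : Prop :=
  m ≤ q ∧ q + q < r ∧ r < N + m ∧ ∀ i ∈ Set.Icc m q, s (r - i) = K.glue (s i)

/-- An embedded loop: all edges are distinct, apart from `e_n = e_0`. -/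
def IsEmbeddedLoop (n : ℕ) (s : ℕ → T × Fin 3) : Prop :=
  K.IsLoop n s ∧ K.EmbeddedOn (Set.Iio n) s

/-- A barbell: a loop which doubles back on itself and becomes embedded when one of the two copies
of the doubled stretch is removed. -/
def IsBarbell (n : ℕ) (s : ℕ → T × Fin 3) : Prop :=
  K.IsLoop n s ∧ ∃ m q r : ℕ, K.DoublesBack n s m q r ∧ K.EmbeddedOn (Set.Iio n \ Set.Icc m q) s

/-- An embedded snake. -/
def IsEmbeddedSnake (n : ℕ) (s : ℕ → T × Fin 3) : Prop :=
  K.IsSnake n s ∧ K.EmbeddedOn (Set.Iic n) s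

/-- A balloon: a snake with `e_n = e_0` which doubles back on itself and becomes embedded when one
of the two copies of the doubled stretch is removed. -/
def IsBalloon (n : ℕ) (s : ℕ → T × Fin 3) : Prop :=
  K.IsSnake n s ∧ K.edge (s n) = K.edge (s 0) ∧
    ∃ m q r : ℕ, K.DoublesBack (n + 1) s m q r ∧ K.EmbeddedOn (Set.Iic n \ Set.Icc m q) s

/-! ### The conditions on the edge data -/

/-- `θ^e(p) = π - p^e`. -/
def theta (p : K.Edge → ℝ) (e : K.Edge) : ℝ := π - p e

open Classical in
/-- The number of the two endpoints of a side that lie at the vertex `v`. -/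
def sideEndCount (v : K.Vertex) (d : T × Fin 3) : ℕ :=
  (Finset.univ.filter fun j : Fin 3 => j ≠ d.2 ∧ K.vertex (d.1, j) = v).card

lemma sideEndCount_glue (v : K.Vertex) (d : T × Fin 3) :
    K.sideEndCount v (K.glue d) = K.sideEndCount v d := by
  classical
  symm
  refine Finset.card_bij (fun j _ => K.perm d.1 d.2 j) ?_ ?_ ?_
  · intro j hj
    simp only [Finset.mem_filter, Finset.mem_univ, true_and] at hj ⊢
    refine ⟨fun h => hj.1 ((K.perm d.1 d.2).injective h), ?_⟩
    rw [← hj.2]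
    exact (Quot.sound ⟨d.2, hj.1.symm, rfl⟩).symm
  · intro a _ b _ h
    exact (K.perm d.1 d.2).injective h
  · intro j hj
    simp only [Finset.mem_filter, Finset.mem_univ, true_and] at hj
    refine ⟨(K.perm d.1 d.2).symm j, ?_, by simp⟩
    have hne : (K.perm d.1 d.2).symm j ≠ d.2 := fun h =>
      hj.1 (((K.perm d.1 d.2).symm_apply_eq).1 h)
    simp only [Finset.mem_filter, Finset.mem_univ, true_and]
    refine ⟨hne, ?_⟩
    rw [← hj.2]
    refine Quot.sound ⟨d.2, hne.symm, ?_⟩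
    simp [glue]

/-- The number of endpoints of the edge `e` that lie at the vertex `v`: how often `e` occurs among
the edges at `v` when these are counted in the universal cover. -/
def endCount (v : K.Vertex) (e : K.Edge) : ℕ :=
  Quot.lift (K.sideEndCount v) (fun d d' h => by subst h; exact (K.sideEndCount_glue v d).symm) e

open Classical in
/-- The edges of the triangles in `S`. -/
def edgesOf [Fintype T] (S : Finset T) : Finset K.Edge :=
  Finset.univ.filter fun e => ∃ d : T × Fin 3, d.1 ∈ S ∧ K.edge d = e

/-- `(n₁)`: the data of the edges at each vertex add up to `2π`. -/
def CondVertex [Fintype T] (p : K.Edge → ℝ) : Prop :=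
  ∀ v : K.Vertex, ∑ e : K.Edge, (K.endCount v e : ℝ) * p e = 2 * π

/-- `(n₂)`: the condition on nonempty sets of triangles. -/
def CondSet [Fintype T] (p : K.Edge → ℝ) : Prop :=
  ∀ S : Finset T, S.Nonempty → π * (S.card : ℝ) < ∑ e ∈ K.edgesOf S, K.theta p e

/-- `(n₃)`: the condition on embedded loops and barbells. -/
def CondLoop (p : K.Edge → ℝ) : Prop :=
  ∀ (n : ℕ) (s : ℕ → T × Fin 3), K.IsEmbeddedLoop n s ∨ K.IsBarbell n s →
    ∑ i ∈ Finset.range n, K.theta p (K.edge (s i)) < n * π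

/-- `(n₄)`: the condition on embedded snakes and balloons, with edges `e_0, …, e_n`. -/
def CondSnake (p : K.Edge → ℝ) : Prop :=
  ∀ (n : ℕ) (s : ℕ → T × Fin 3), K.IsEmbeddedSnake n s ∨ K.IsBalloon n s →
    ∑ i ∈ Finset.range (n + 1), K.theta p (K.edge (s i)) < (n + 2) * π

/-- The set `N`. -/
def edgeData [Fintype T] : Set (K.Edge → ℝ) :=
  {p | (∀ e, p e ∈ Set.Ioo (-π) π) ∧
    K.CondVertex p ∧ K.CondSet p ∧ K.CondLoop p ∧ K.CondSnake p}

end TriangleGluing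

end

noncomputable section

/-! ### Reduction of angle systems to splittings of the edge data -/

namespace TriangleGluing

variable {T : Type*} (K : TriangleGluing T)

/-! Put `w = π/2 - ψ^e_t` on each side. An angle is then `π` minus the weights of the two sides
along it, so positive angles and negative curvature become the conditions `IsAdmissible` on each
triangle, and `p` lies in the image iff (n₁) holds and the numbers `θ^e(p)` split into admissible
weights (`mem_image_Psi_iff`). That such a splitting forces (n₂)–(n₄) follows by regrouping the sums
of `θ` by triangles instead of edges.

The converse is linear duality (`exists_isSplitting`). Without an admissible splitting, Hahn–Banach
separates the admissible weights from the affine space of splittings by a functional with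
coefficients `c` that agree on glued sides. On each triangle it is tested at a vertex of the closed
tetrahedron of weights, which yields local bounds `g`, `m` for the positive and negative parts of
`c`.

The negative part is cut into layers, each governed by (n₂): `CondSet.sum_lt`. The positive part is
turned into a flow of turns inside triangles, which decomposes into loops, barbells, snakes and
balloons governed by (n₃) and (n₄): `sum_mul_theta_lt`. The two strict bounds contradict the
separation. -/

@[simp] lemma glue_glue (d : T × Fin 3) : K.glue (K.glue d) = d := by
  obtain ⟨t, i⟩ := d
  simp only [glue, Prod.mk.injEq]
  refine ⟨K.nbr_nbr t i, ?_⟩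
  rw [K.perm_perm]
  simp

lemma glue_ne (d : T × Fin 3) : K.glue d ≠ d := K.no_fold d.1 d.2

lemma glue_eq_iff {d d' : T × Fin 3} : K.glue d = d' ↔ d = K.glue d' :=
  ⟨fun h => by rw [← h, glue_glue], fun h => by rw [h, glue_glue]⟩

@[simp] lemma edge_glue (d : T × Fin 3) : K.edge (K.glue d) = K.edge d :=
  (Quot.sound (r := fun d d' : T × Fin 3 => d' = K.glue d) rfl).symm

lemma edge_eq_iff {d d' : T × Fin 3} : K.edge d = K.edge d' ↔ d' = d ∨ d' = K.glue d := by
  constructor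
  · intro h
    have h' := Quot.eqvGen_exact h
    induction h' with
    | rel _ _ hr => exact Or.inr hr
    | refl _ => exact Or.inl rfl
    | symm a b _ ih =>
      rcases ih (Quot.eqvGen_sound ‹_›) with h | h
      · exact Or.inl h.symm
      · exact Or.inr (by rw [h, glue_glue])
    | trans a b c h₁ h₂ ih₁ ih₂ =>
      rcases ih₁ (Quot.eqvGen_sound h₁) with rfl | rfl <;>
      rcases ih₂ (Quot.eqvGen_sound h₂) with rfl | rfl <;> simp
  · rintro (rfl | rfl) <;> simp

lemma edge_surjective : Function.Surjective K.edge := Quot.mk_surjective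

lemma sideDefect_apply (d : T × Fin 3) (x : T × Fin 3 → ℝ) :
    sideDefect d x = (x (d.1, d.2 + 1) + x (d.1, d.2 + 2) - x d) / 2 := by
  simp [sideDefect]
  ring

/-- The weights `π / 2 - ψ^e_t` of a negative-curvature angle system, seen from a triangle: their
sum over the triangle exceeds `π`, and the sum of any two of them is less than `π`. -/
def IsAdmissible (w : T × Fin 3 → ℝ) : Prop :=
  (∀ t, π < ∑ i, w (t, i)) ∧ ∀ t i j, i ≠ j → w (t, i) + w (t, j) < π

/-- A splitting of `θ^e(p)` between the two sides lying on `e`. -/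
def IsSplitting (p : K.Edge → ℝ) (w : T × Fin 3 → ℝ) : Prop :=
  ∀ d, w d + w (K.glue d) = K.theta p (K.edge d)

section Fintype

variable [Fintype T]

open Classical in
lemma sum_fiber_edge (h : T × Fin 3 → ℝ) (d : T × Fin 3) :
    ∑ d' : T × Fin 3 with K.edge d' = K.edge d, h d' = h d + h (K.glue d) := by
  have : (Finset.univ.filter fun d' => K.edge d' = K.edge d) = {d, K.glue d} := by
    ext d'
    simp only [Finset.mem_filter, Finset.mem_univ, true_and, Finset.mem_insert,
      Finset.mem_singleton]
    rw [eq_comm, edge_eq_iff]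
  rw [this, Finset.sum_pair (K.glue_ne d).symm]

open Classical in
lemma sum_comp_edge (h : K.Edge → ℝ) : ∑ d, h (K.edge d) = 2 * ∑ e, h e := by
  rw [← Finset.sum_fiberwise (s := Finset.univ) (g := K.edge), Finset.mul_sum]
  refine Finset.sum_congr rfl fun e _ => ?_
  obtain ⟨d, rfl⟩ := K.edge_surjective e
  rw [K.sum_fiber_edge]
  simp [two_mul]

lemma Psi_edge (x : T × Fin 3 → ℝ) (d : T × Fin 3) :
    K.Psi x (K.edge d) = sideDefect d x + sideDefect (K.glue d) x := by
  classical
  rw [← K.sum_fiber_edge (fun d => sideDefect d x)]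
  simp only [Psi, LinearMap.pi_apply, LinearMap.coe_sum, Finset.sum_apply]

/-- The defects of the two sides of a triangle that meet at a corner add up to the angle there.
Hence (n₁) is exactly the angle condition at the vertices. -/
lemma sum_endCount_Psi (v : K.Vertex) (x : T × Fin 3 → ℝ) :
    ∑ e : K.Edge, (K.endCount v e : ℝ) * K.Psi x e = K.angleSum v x := by
  classical
  have h : ∀ e : K.Edge, (K.endCount v e : ℝ) * K.Psi x e =
      ∑ d : T × Fin 3 with K.edge d = e, (K.sideEndCount v d : ℝ) * sideDefect d x := by
    intro e
    obtain ⟨d, rfl⟩ := K.edge_surjective e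
    rw [K.sum_fiber_edge (fun d => (K.sideEndCount v d : ℝ) * sideDefect d x), K.Psi_edge,
      sideEndCount_glue, mul_add]
    rfl
  simp only [h]
  have hf := Finset.sum_fiberwise Finset.univ K.edge
    fun d => (K.sideEndCount v d : ℝ) * sideDefect d x
  refine Eq.trans (by convert hf) ?_
  simp only [angleSum, sideEndCount, Finset.card_filter, Finset.sum_filter]
  rw [Fintype.sum_prod_type, Fintype.sum_prod_type]
  refine Finset.sum_congr rfl fun t _ => ?_
  simp only [Fin.sum_univ_three, sideDefect_apply]
  by_cases h0 : K.vertex (t, 0) = v <;> by_cases h1 : K.vertex (t, 1) = v <;>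
    by_cases h2 : K.vertex (t, 2) = v <;> simp [h0, h1, h2] <;> ring

lemma mem_image_Psi_iff (p : K.Edge → ℝ) :
    p ∈ K.Psi '' K.angleSystems ↔
      K.CondVertex p ∧ ∃ w, IsAdmissible w ∧ K.IsSplitting p w := by
  constructor
  · rintro ⟨x, ⟨hv, hk, hx⟩, rfl⟩
    refine ⟨fun v => by rw [K.sum_endCount_Psi, hv], fun d => π / 2 - sideDefect d x,
      ⟨fun t => ?_, fun t i j hij => ?_⟩, fun d => ?_⟩
    · have := hk t
      simp only [curvature, Fin.sum_univ_three] at this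
      simp only [Fin.sum_univ_three, sideDefect_apply]
      simp
      linarith
    · have h0 := (hx (t, 0)).1
      have h1 := (hx (t, 1)).1
      have h2 := (hx (t, 2)).1
      fin_cases i <;> fin_cases j <;> simp [sideDefect_apply] at hij ⊢ <;> linarith
    · rw [theta, K.Psi_edge]
      ring
  · rintro ⟨hp, w, ⟨hs, hw⟩, hsp⟩
    -- This inverts `w = π/2 - sideDefect`: the two sides named here meet at the corner `d`.
    let x : T × Fin 3 → ℝ := fun d => π - w (d.1, d.2 + 1) - w (d.1, d.2 + 2)
    have hy : ∀ d, sideDefect d x = π / 2 - w d := by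
      rintro ⟨t, i⟩
      rw [sideDefect_apply]
      fin_cases i <;> simp [x] <;> ring
    have hpx : K.Psi x = p := by
      ext e
      obtain ⟨d, rfl⟩ := K.edge_surjective e
      have := hsp d
      rw [theta] at this
      rw [K.Psi_edge, hy, hy]
      linarith
    have hpos : ∀ c, 0 < x c := by
      rintro ⟨t, i⟩
      have := hw t (i + 1) (i + 2) (by fin_cases i <;> simp)
      simp only [x]
      linarith
    have hk : ∀ t, curvature t x < 0 := by
      intro t
      have := hs t
      simp only [Fin.sum_univ_three] at this
      simp [curvature, Fin.sum_univ_three, x]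
      linarith
    refine ⟨x, ⟨fun v => ?_, hk, fun c => ⟨hpos c, ?_⟩⟩, hpx⟩
    · rw [← K.sum_endCount_Psi, hpx, hp v]
    · obtain ⟨t, i⟩ := c
      have h := hk t
      have h0 := hpos (t, 0)
      have h1 := hpos (t, 1)
      have h2 := hpos (t, 2)
      simp only [curvature, Fin.sum_univ_three] at h
      fin_cases i <;> simp <;> linarith

end Fintype

end TriangleGluing

/-! ### Necessity of the conditions -/

namespace TriangleGluing

variable {T : Type*} (K : TriangleGluing T)

lemma IsAdmissible.add_lt {w : T × Fin 3 → ℝ} (hw : IsAdmissible w) {d d' : T × Fin 3}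
    (h : d.1 = d'.1) (hne : d ≠ d') : w d + w d' < π := by
  obtain ⟨t, i⟩ := d
  obtain ⟨t', j⟩ := d'
  obtain rfl : t = t' := h
  exact hw.2 t i j fun h => hne (by rw [h])

/-- All three weights exceed `π` together, while the other two stay below `π`. -/
lemma IsAdmissible.pos {w : T × Fin 3 → ℝ} (hw : IsAdmissible w) (d : T × Fin 3) : 0 < w d := by
  obtain ⟨t, i⟩ := d
  have h := hw.1 t
  rw [Fin.sum_univ_three] at h
  have h1 := hw.2 t 0 1 (by decide)
  have h2 := hw.2 t 0 2 (by decide)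
  have h3 := hw.2 t 1 2 (by decide)
  fin_cases i <;> simp <;> linarith

lemma IsAdmissible.lt_pi {w : T × Fin 3 → ℝ} (hw : IsAdmissible w) (d : T × Fin 3) :
    w d < π := by
  have hne : d ≠ (d.1, d.2 + 1) := by
    obtain ⟨t, i⟩ := d
    fin_cases i <;> simp
  have h := hw.add_lt (d := d) (d' := (d.1, d.2 + 1)) rfl hne
  have h' := hw.pos (d.1, d.2 + 1)
  linarith

variable {K} {p : K.Edge → ℝ} {w : T × Fin 3 → ℝ}

lemma IsSplitting.mem_Ioo (hw : IsAdmissible w) (hp : K.IsSplitting p w) (e : K.Edge) :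
    p e ∈ Set.Ioo (-π) π := by
  obtain ⟨d, rfl⟩ := K.edge_surjective e
  have h := hp d
  rw [theta] at h
  have h1 := hw.pos d
  have h2 := hw.pos (K.glue d)
  have h3 := hw.lt_pi d
  have h4 := hw.lt_pi (K.glue d)
  constructor <;> linarith

/-- Splitting each `θ` over its two sides collects all sides of the triangles in `S`, worth more
than `π` per triangle, plus sides outside `S` of positive weight. -/
lemma IsSplitting.condSet [Fintype T] (hw : IsAdmissible w) (hp : K.IsSplitting p w) : K.CondSet p := by
  classical
  intro S hS
  have h1 : ∑ e ∈ K.edgesOf S, K.theta p e =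
      ∑ d : T × Fin 3 with K.edge d ∈ K.edgesOf S, w d := by
    rw [← Finset.sum_fiberwise_of_maps_to (s := Finset.univ.filter fun d => K.edge d ∈ K.edgesOf S)
      (t := K.edgesOf S) (g := K.edge) (fun d hd => (Finset.mem_filter.1 hd).2)]
    refine Finset.sum_congr rfl fun e he => ?_
    obtain ⟨d, rfl⟩ := K.edge_surjective e
    rw [← hp d, ← K.sum_fiber_edge w d, Finset.filter_filter]
    refine Finset.sum_congr ?_ fun _ _ => rfl
    ext d'
    simp only [Finset.mem_filter, Finset.mem_univ, true_and]
    exact ⟨fun h => ⟨h ▸ he, h⟩, fun h => h.2⟩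
  have h2 : ∑ d ∈ S ×ˢ (Finset.univ : Finset (Fin 3)), w d ≤
      ∑ d : T × Fin 3 with K.edge d ∈ K.edgesOf S, w d := by
    refine Finset.sum_le_sum_of_subset_of_nonneg ?_ fun d _ _ => (hw.pos d).le
    intro d hd
    simp only [Finset.mem_product, Finset.mem_univ, and_true] at hd
    simp only [edgesOf, Finset.mem_filter, Finset.mem_univ, true_and]
    exact ⟨d, hd, rfl⟩
  rw [h1]
  refine lt_of_lt_of_le ?_ h2
  rw [Finset.sum_product]
  calc π * (S.card : ℝ) = ∑ t ∈ S, π := by simp [mul_comm]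
    _ < _ := Finset.sum_lt_sum_of_nonempty hS fun t _ => hw.1 t

lemma IsAdmissible.sum_lt (hw : IsAdmissible w) {n : ℕ}
    {s : ℕ → T × Fin 3} (hs : K.IsSnake n s) (hn : 0 < n) :
    ∑ i ∈ Finset.range n, (w (s i) + w (K.glue (s (i + 1)))) < n * π := by
  calc _ < ∑ i ∈ Finset.range n, π := by
        refine Finset.sum_lt_sum_of_nonempty (by simpa using hn.ne') fun i hi => ?_
        obtain ⟨h1, h2⟩ := hs i (Finset.mem_range.1 hi)
        exact hw.add_lt h1.symm h2.symm
    _ = n * π := by simp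

lemma IsSplitting.condLoop (hw : IsAdmissible w) (hp : K.IsSplitting p w) : K.CondLoop p := by
  intro n s h
  have hl : K.IsLoop n s := h.elim (fun h => h.1) fun h => h.1
  have h1 := hw.sum_lt hl.1 hl.2.1
  rw [Finset.sum_add_distrib] at h1
  have h2 := Finset.sum_range_succ (fun i => w (K.glue (s i))) n
  rw [Finset.sum_range_succ', hl.2.2] at h2
  simp only [← hp _, Finset.sum_add_distrib]
  linarith

/-- Each of the `n` turns pairs two sides of one triangle, worth less than `π`. The two unpaired end
weights cost less than `π` each, whence `n + 2`. -/
lemma IsSplitting.condSnake (hw : IsAdmissible w) (hp : K.IsSplitting p w) : K.CondSnake p := by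
  intro n s h
  have hl : K.IsSnake n s := h.elim (fun h => h.1) fun h => h.1
  simp only [← hp _, Finset.sum_add_distrib]
  rw [Finset.sum_range_succ, Finset.sum_range_succ' (fun i => w (K.glue (s i)))]
  have h2 := hw.lt_pi (s n)
  have h3 := hw.lt_pi (K.glue (s 0))
  rcases Nat.eq_zero_or_pos n with rfl | hn
  · simp
    linarith
  · have h1 := hw.sum_lt hl hn
    rw [Finset.sum_add_distrib] at h1
    linarith

end TriangleGluing

/-! ### Finding loops, barbells, snakes and balloons in a transition relation -/

namespace TriangleGluing

variable {T : Type*} (K : TriangleGluing T)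

/-- A transition relation between the sides of a triangle: it is symmetric, and a side that has a
transition is glued to another such side. -/
structure IsTransition (R : T × Fin 3 → T × Fin 3 → Prop) : Prop where
  symm : ∀ {d d'}, R d d' → R d' d
  fst_eq : ∀ {d d'}, R d d' → d.1 = d'.1
  glue : ∀ {d d'}, R d d' → ∃ d'', R (K.glue d) d''

/-- All turns of the first `n` triangles of `s` are allowed by `R`. -/
def Follows (R : T × Fin 3 → T × Fin 3 → Prop) (n : ℕ) (s : ℕ → T × Fin 3) : Prop :=
  ∀ i < n, R (s i) (K.glue (s (i + 1)))

/-- The walk `u` up to step `p`, where it is to meet its own step `i` in the opposite direction,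
and then back along itself. -/
def turnBack (u : ℕ → T × Fin 3) (p i t : ℕ) : T × Fin 3 :=
  if t < p then u t else K.glue (u (p + i - t))

lemma edge_turnBack (u : ℕ → T × Fin 3) (p i t : ℕ) :
    K.edge (K.turnBack u p i t) = K.edge (u (if t < p then t else p + i - t)) := by
  unfold turnBack
  split_ifs <;> simp

variable {K} {R : T × Fin 3 → T × Fin 3 → Prop}

lemma Follows.turnBack (hR : K.IsTransition R) {u : ℕ → T × Fin 3} {p i : ℕ}
    (hu : K.Follows R p u) (hip : i < p) (h : u p = K.glue (u i)) :
    K.Follows R (p + i) (K.turnBack u p i) := by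
  intro t ht
  rcases lt_trichotomy (t + 1) p with h1 | h1 | h1
  · rw [TriangleGluing.turnBack, TriangleGluing.turnBack, if_pos (by omega), if_pos h1]
    exact hu t (by omega)
  · rw [TriangleGluing.turnBack, TriangleGluing.turnBack, if_pos (by omega), if_neg (by omega),
      show p + i - (t + 1) = i by omega, ← h, ← h1]
    exact hu t (by omega)
  · rw [TriangleGluing.turnBack, TriangleGluing.turnBack, if_neg (by omega), if_neg (by omega),
      glue_glue, show p + i - t = p + i - (t + 1) + 1 by omega]
    exact hR.symm (hu _ (by omega))

lemma Follows.isSnake (hR : K.IsTransition R) {n : ℕ} {s : ℕ → T × Fin 3} (h : K.Follows R n s)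
    (hs : ∀ i < n, s i ≠ K.glue (s (i + 1))) : K.IsSnake n s :=
  fun i hi => ⟨(hR.fst_eq (h i hi)).symm, (hs i hi).symm⟩

/-- A turn from a side to itself would repeat an edge at consecutive steps. Distinctness allows this
only for `n = 1`, where it would glue a side to itself. -/
lemma Follows.isEmbeddedLoop (hR : K.IsTransition R) {n : ℕ} {s : ℕ → T × Fin 3}
    (h : K.Follows R n s) (hn : 0 < n) (hs : s n = s 0) (he : K.EmbeddedOn (Set.Iio n) s) :
    K.IsEmbeddedLoop n s := by
  refine ⟨⟨h.isSnake hR fun i hi h' => ?_, hn, hs⟩, he⟩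
  have h1 : K.edge (s i) = K.edge (s (i + 1)) := by rw [h', edge_glue]
  rcases Nat.lt_or_ge (i + 1) n with h2 | h2
  · have := he hi h2 h1
    omega
  · obtain rfl : i + 1 = n := by omega
    have h3 : i = 0 := he hi hn (by simpa [hs] using h1)
    subst h3
    rw [hs] at h'
    exact K.glue_ne _ h'.symm

lemma IsTransition.exists_follows (hR : K.IsTransition R) {x x' : T × Fin 3} (hx : R x x') :
    ∃ s : ℕ → T × Fin 3, s 0 = x ∧ ∀ n, K.Follows R n s := by
  have hnext : ∀ d, ∃ d', (∃ d'', R d d'') → R d (K.glue d') := by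
    intro d
    by_cases h : ∃ d'', R d d''
    · obtain ⟨d'', h⟩ := h
      exact ⟨K.glue d'', fun _ => by rwa [glue_glue]⟩
    · exact ⟨d, fun h' => (h h').elim⟩
  choose next hnext using hnext
  have hact : ∀ i, ∃ d, R (next^[i] x) d := by
    intro i
    induction i with
    | zero => exact ⟨x', hx⟩
    | succ i ih =>
      rw [Function.iterate_succ_apply']
      have := hR.glue (hR.symm (hnext _ ih))
      rwa [glue_glue] at this
  refine ⟨fun i => next^[i] x, rfl, fun n i _ => ?_⟩
  have := hnext _ (hact i)
  rwa [← Function.iterate_succ_apply' (f := next)] at this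

/-- Pigeonhole with `p` minimal. The starting index `a` allows a repetition involving earlier steps
to be ignored. -/
lemma exists_first_repeat {E : Type*} [Finite E] (f : ℕ → E) (a : ℕ) :
    ∃ p i, a ≤ i ∧ i < p ∧ f p = f i ∧ Set.InjOn f (Set.Ico a p) := by
  classical
  have hex : ∃ p i, a ≤ i ∧ i < p ∧ f p = f i := by
    obtain ⟨x, y, hxy, h⟩ := Finite.exists_ne_map_eq_of_infinite fun k => f (a + k)
    rcases lt_or_gt_of_ne hxy with h1 | h1
    · exact ⟨a + y, a + x, by omega, by omega, h.symm⟩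
    · exact ⟨a + x, a + y, by omega, by omega, h⟩
  obtain ⟨i, h1, h2, h3⟩ := Nat.find_spec hex
  refine ⟨Nat.find hex, i, h1, h2, h3, fun x hx y hy hxy => ?_⟩
  by_contra hne
  rcases lt_or_gt_of_ne hne with h | h
  · exact Nat.find_min hex hy.2 ⟨x, hx.1, h, hxy.symm⟩
  · exact Nat.find_min hex hx.2 ⟨y, hy.1, h, hxy⟩

/-- There is an embedded loop or a barbell that follows `R`. -/
def HasLoop (K : TriangleGluing T) (R : T × Fin 3 → T × Fin 3 → Prop) : Prop :=
  ∃ n s, (K.IsEmbeddedLoop n s ∨ K.IsBarbell n s) ∧ K.Follows R n s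

/-- There is an embedded snake or a balloon that follows `R` and whose ends are transitions of `R`
from a side to itself. -/
def HasSnake (K : TriangleGluing T) (R : T × Fin 3 → T × Fin 3 → Prop) : Prop :=
  ∃ n s, (K.IsEmbeddedSnake n s ∨ K.IsBalloon n s) ∧ K.Follows R n s ∧
    R (K.glue (s 0)) (K.glue (s 0)) ∧ R (s n) (s n)

lemma IsTransition.hasLoop_of_eq (hR : K.IsTransition R) {s : ℕ → T × Fin 3} {i p : ℕ}
    (hs : K.Follows R p s) (hip : i < p) (h : s p = s i)
    (he : K.EmbeddedOn (Set.Ico i p) s) : K.HasLoop R := by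
  have hf : K.Follows R (p - i) fun t => s (i + t) := fun t ht => hs (i + t) (by omega)
  refine ⟨p - i, fun t => s (i + t), Or.inl (hf.isEmbeddedLoop hR (by omega) ?_ ?_), hf⟩
  · simpa [show i + (p - i) = p by omega] using h
  · intro a ha b hb hab
    simp only [Set.mem_Iio] at ha hb
    have := he (x₁ := i + a) (x₂ := i + b) ⟨by omega, by omega⟩ ⟨by omega, by omega⟩ hab
    omega

/-- Walk away from the end `x` until an edge repeats. A repetition in the same direction closes a
loop. In the opposite direction the walk can retrace its stem to `x`, forming a balloon, unless it
has just turned from a side to itself, which makes it a snake with a second end. -/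
lemma IsTransition.hasLoop_or_hasSnake_of_end [Finite T] (hR : K.IsTransition R)
    {x : T × Fin 3} (hx : R x x) : K.HasLoop R ∨ K.HasSnake R := by
  obtain ⟨x', hx'⟩ := hR.glue hx
  obtain ⟨u, hu0, hu⟩ := hR.exists_follows hx'
  obtain ⟨p, i, -, hip, hpi, hinj⟩ := exists_first_repeat (fun t => K.edge (u t)) 0
  have h0 : R (K.glue (u 0)) (K.glue (u 0)) := by rwa [hu0, glue_glue]
  rcases K.edge_eq_iff.1 hpi.symm with h | h
  · left
    exact hR.hasLoop_of_eq (hu p) hip h (hinj.mono (Set.Ico_subset_Ico_left (Nat.zero_le i)))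
  right
  rcases Nat.lt_or_ge (i + 1) p with h1 | h1
  · have hf := (hu p).turnBack hR hip h
    have hn : K.turnBack u p i (p + i) = K.glue (u 0) := by simp [TriangleGluing.turnBack]
    have h00 : K.turnBack u p i 0 = u 0 := by rw [TriangleGluing.turnBack, if_pos (by omega)]
    refine ⟨p + i, K.turnBack u p i, Or.inr ⟨hf.isSnake hR fun t ht h' => ?_, ?_, 0, i, p + i,
      ⟨Nat.zero_le i, by omega, by omega, fun t ht => ?_⟩, ?_⟩, hf, ?_, ?_⟩
    · have h2 := congrArg K.edge h'
      rw [edge_glue, edge_turnBack, edge_turnBack] at h2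
      have h3 := hinj ⟨Nat.zero_le _, by split_ifs <;> omega⟩
        ⟨Nat.zero_le _, by split_ifs <;> omega⟩ h2
      split_ifs at h3 <;> omega
    · rw [hn, h00, edge_glue]
    · have ht' := ht.2
      rw [TriangleGluing.turnBack, TriangleGluing.turnBack, if_neg (by omega), if_pos (by omega),
        show p + i - (p + i - t) = t by omega]
    · intro a ha b hb hab
      simp only [Set.mem_sdiff, Set.mem_Iic, Set.mem_Icc, not_and, not_le] at ha hb
      have ha2 := ha.2 (Nat.zero_le _)
      have hb2 := hb.2 (Nat.zero_le _)
      simp only [edge_turnBack] at hab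
      have h3 := hinj ⟨Nat.zero_le _, by split_ifs <;> omega⟩
        ⟨Nat.zero_le _, by split_ifs <;> omega⟩ hab
      split_ifs at h3 <;> omega
    · rwa [h00]
    · rwa [hn]
  · obtain rfl : p = i + 1 := by omega
    have he : K.EmbeddedOn (Set.Iic i) u :=
      hinj.mono fun t ht => Set.mem_Ico.2 ⟨Nat.zero_le t, Nat.lt_succ_of_le ht⟩
    refine ⟨i, u, Or.inl ⟨(hu i).isSnake hR fun t ht h' => ?_, he⟩, hu i, h0, ?_⟩
    · have h2 : K.edge (u t) = K.edge (u (t + 1)) := by rw [h', edge_glue]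
      have := he (Set.mem_Iic.2 ht.le) (Set.mem_Iic.2 ht) h2
      omega
    · have := hu (i + 1) i (by omega)
      rwa [h, glue_glue] at this

/-- If the first repeated edge is crossed backwards, the walk has described a ring and is leaving
it. It is continued to the next repetition, which closes a loop, returns to the first ring, or ends
a second ring. -/
lemma IsTransition.hasLoop_of_no_end [Finite T] (hR : K.IsTransition R) (hirr : ∀ d, ¬ R d d)
    {x x' : T × Fin 3} (hx : R x x') : K.HasLoop R := by
  obtain ⟨s₀, -, hs₀⟩ := hR.exists_follows hx
  obtain ⟨l₀, j, -, hjl, hlj, hinj₀⟩ := exists_first_repeat (fun t => K.edge (s₀ t)) 0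
  rcases K.edge_eq_iff.1 hlj.symm with h | h
  · exact hR.hasLoop_of_eq (hs₀ l₀) hjl h (hinj₀.mono (Set.Ico_subset_Ico_left (Nat.zero_le j)))
  obtain ⟨s, l, hl, hs, hsl, hinjl⟩ : ∃ (s : ℕ → T × Fin 3) (l : ℕ), 0 < l ∧
      (∀ n, K.Follows R n s) ∧ s l = K.glue (s 0) ∧
      Set.InjOn (fun t => K.edge (s t)) (Set.Ico 0 l) := by
    refine ⟨fun t => s₀ (j + t), l₀ - j, by omega, fun n t _ => hs₀ (j + t + 1) (j + t) (by omega),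
      by simpa [show j + (l₀ - j) = l₀ by omega] using h, fun a ha b hb hab => ?_⟩
    have ha' := ha.2
    have hb' := hb.2
    have := hinj₀ (x₁ := j + a) (x₂ := j + b) ⟨by omega, by omega⟩ ⟨by omega, by omega⟩ hab
    omega
  obtain ⟨p, i, hi, hip, hpi, hinj⟩ := exists_first_repeat (fun t => K.edge (s t)) 1
  have hlp : l < p := by
    by_contra hlp
    rcases Nat.lt_or_ge p l with h1 | h1
    · have := hinjl ⟨Nat.zero_le _, h1⟩ ⟨Nat.zero_le _, by omega⟩ hpi
      omega
    · obtain rfl : p = l := by omega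
      have := hinjl (x₁ := 0) (x₂ := i) ⟨le_rfl, hl⟩ ⟨Nat.zero_le _, hip⟩ (by
        simp only
        rw [← hpi, hsl, edge_glue])
      omega
  rcases K.edge_eq_iff.1 hpi.symm with h | h
  · exact hR.hasLoop_of_eq (hs p) hip h (hinj.mono (Set.Ico_subset_Ico_left hi))
  have hf := (hs p).turnBack hR hip h
  rcases Nat.lt_or_ge i l with hil | hil
  -- The walk runs backwards into the first ring; following that ring back to edge `0` gives the
  -- crossing `s l` again, so a loop closes.
  · refine hR.hasLoop_of_eq (i := l) hf (by omega) ?_ fun a ha b hb hab => ?_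
    · rw [TriangleGluing.turnBack, TriangleGluing.turnBack, if_neg (by omega), if_pos hlp, hsl,
        Nat.sub_self]
    · obtain ⟨ha1, ha2⟩ := ha
      obtain ⟨hb1, hb2⟩ := hb
      simp only [edge_turnBack] at hab
      have h3 := hinj ⟨by split_ifs <;> omega, by split_ifs <;> omega⟩
        ⟨by split_ifs <;> omega, by split_ifs <;> omega⟩ hab
      split_ifs at h3 <;> omega
  -- The barbell: first ring, bar `e_l, …, e_i`, second ring, bar reversed. Edges `0` and `l`
  -- coincide, so it starts at index `1`; the default value `s 1` is the closing crossing.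
  · let b : ℕ → T × Fin 3 := fun t =>
      if t + 1 ≤ p + i - l then K.turnBack s p i (t + 1) else s 1
    have hb : ∀ t, t + 1 ≤ p + i - l → b t = K.turnBack s p i (t + 1) := fun t ht => if_pos ht
    have hbn : b (p + i - l) = s 1 := if_neg (by omega)
    have hfb : K.Follows R (p + i - l) b := by
      intro t ht
      rcases Nat.lt_or_ge (t + 1) (p + i - l) with h1 | h1
      · rw [hb _ (by omega), hb _ (by omega)]
        exact hf (t + 1) (by omega)
      · have h2 : t + 1 = p + i - l := by omega
        rw [hb _ (by omega), h2, hbn, TriangleGluing.turnBack, if_neg (by omega),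
          show p + i - (p + i - l) = l by omega, hsl, glue_glue]
        exact hs 1 0 (by omega)
    refine ⟨p + i - l, b, Or.inr ⟨⟨hfb.isSnake hR fun t ht h' => ?_, by omega, ?_⟩, l - 1, i - 1,
      p + i - 2, ⟨by omega, by omega, by omega, fun t ht => ?_⟩, fun x hx y hy hxy => ?_⟩, hfb⟩
    · have h1 := hfb t ht
      rw [← h'] at h1
      exact hirr _ h1
    · rw [hbn, hb _ (by omega), TriangleGluing.turnBack, if_pos (by omega)]
    · obtain ⟨ht1, ht2⟩ := ht
      rw [hb _ (by omega), hb _ (by omega), TriangleGluing.turnBack, TriangleGluing.turnBack,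
        if_neg (by omega), if_pos (by omega)]
      congr 2
      omega
    · simp only [Set.mem_sdiff, Set.mem_Iio, Set.mem_Icc, not_and, not_le] at hx hy
      obtain ⟨hx1, hx2⟩ := hx
      obtain ⟨hy1, hy2⟩ := hy
      simp only at hxy
      rw [hb _ (by omega), hb _ (by omega), edge_turnBack, edge_turnBack] at hxy
      have h3 := hinj ⟨by split_ifs <;> omega, by split_ifs <;> omega⟩
        ⟨by split_ifs <;> omega, by split_ifs <;> omega⟩ hxy
      split_ifs at h3 <;> omega

lemma IsTransition.hasLoop_or_hasSnake [Finite T] (hR : K.IsTransition R)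
    {x x' : T × Fin 3} (hx : R x x') : K.HasLoop R ∨ K.HasSnake R := by
  by_cases h : ∃ d, R d d
  · obtain ⟨d, hd⟩ := h
    exact hR.hasLoop_or_hasSnake_of_end hd
  · exact Or.inl (hR.hasLoop_of_no_end (not_exists.1 h) hx)

end TriangleGluing

/-! ### Flows of turns and their decomposition -/

namespace TriangleGluing

variable {T : Type*} (K : TriangleGluing T)

open Classical in
/-- The bound `π` for the sum of the weights of two sides of a triangle, and the bound `2π` for
twice the weight of a side. -/
def turnBound (d d' : T × Fin 3) : ℝ := if d = d' then 2 * π else π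

open Classical in
/-- The symmetric matrix of a single turn. -/
def turn (a b d d' : T × Fin 3) : ℝ :=
  (if d = a ∧ d' = b then 1 else 0) + if d = b ∧ d' = a then 1 else 0

lemma turn_nonneg (a b d d' : T × Fin 3) : 0 ≤ turn a b d d' := by
  unfold turn
  positivity

lemma turn_symm (a b d d' : T × Fin 3) : turn a b d d' = turn a b d' d := by
  unfold turn
  split_ifs <;> first | (exfalso; tauto) | simp

lemma turn_self_pos (a b : T × Fin 3) : 0 < turn a b a b := by
  unfold turn
  rw [if_pos ⟨rfl, rfl⟩]
  positivity

lemma eq_or_eq_of_turn_ne_zero {a b d d' : T × Fin 3} (h : turn a b d d' ≠ 0) :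
    (d = a ∧ d' = b) ∨ (d = b ∧ d' = a) := by
  unfold turn at h
  by_contra! h'
  rw [if_neg fun h => h'.1 h.1 h.2, if_neg fun h => h'.2 h.1 h.2] at h
  simp at h

/-- The turns of a walk. -/
def walkTurns (n : ℕ) (s : ℕ → T × Fin 3) (d d' : T × Fin 3) : ℝ :=
  ∑ i ∈ Finset.range n, turn (s i) (K.glue (s (i + 1))) d d'

lemma walkTurns_nonneg (n : ℕ) (s : ℕ → T × Fin 3) (d d' : T × Fin 3) :
    0 ≤ K.walkTurns n s d d' :=
  Finset.sum_nonneg fun _ _ => turn_nonneg _ _ _ _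

variable {K}

lemma Follows.of_walkTurns_ne_zero {R : T × Fin 3 → T × Fin 3 → Prop} (hR : K.IsTransition R)
    {n : ℕ} {s : ℕ → T × Fin 3} (hs : K.Follows R n s) {d d' : T × Fin 3}
    (h : K.walkTurns n s d d' ≠ 0) : R d d' := by
  obtain ⟨i, hi, h⟩ := Finset.exists_ne_zero_of_sum_ne_zero h
  have := hs i (Finset.mem_range.1 hi)
  rcases eq_or_eq_of_turn_ne_zero h with ⟨rfl, rfl⟩ | ⟨rfl, rfl⟩
  · exact this
  · exact hR.symm this

open Classical in
lemma sum_crossings_glue (n : ℕ) (s : ℕ → T × Fin 3) (d : T × Fin 3) :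
    (∑ i ∈ Finset.range n, if K.glue d = s i then (1 : ℝ) else 0) +
        ∑ i ∈ Finset.range n, (if K.glue d = K.glue (s i) then (1 : ℝ) else 0) =
      (∑ i ∈ Finset.range n, if d = s i then (1 : ℝ) else 0) +
        ∑ i ∈ Finset.range n, if d = K.glue (s i) then (1 : ℝ) else 0 := by
  simp only [K.glue_eq_iff, glue_glue]
  rw [add_comm]

/-- Three nonnegative weights of the sides of a triangle are the row sums of a symmetric matrix of
turns. -/
lemma exists_turn_matrix (r : Fin 3 → ℝ) (hr : ∀ i, 0 ≤ r i) (g : ℝ) (hg : ∀ i, r i ≤ g)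
    (hg2 : ∑ i, r i ≤ 2 * g) :
    ∃ M : Fin 3 → Fin 3 → ℝ, (∀ i j, 0 ≤ M i j) ∧ (∀ i j, M i j = M j i) ∧
      (∀ i, ∑ j, M i j = r i) ∧
      ∑ i, ∑ j, M i j * (if i = j then 2 * π else π) ≤ 2 * π * g := by
  -- If one weight exceeds the sum of the others, the excess becomes a turn from that side to
  -- itself. Otherwise the off-diagonal entries alone solve the row equations. The total is the
  -- largest weight or half the sum, both at most `g`.
  have key : ∃ a b c x y z : ℝ, 0 ≤ a ∧ 0 ≤ b ∧ 0 ≤ c ∧ 0 ≤ x ∧ 0 ≤ y ∧ 0 ≤ z ∧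
      x + b + c = r 0 ∧ y + a + c = r 1 ∧ z + a + b = r 2 ∧ a + b + c + x + y + z ≤ g := by
    rw [Fin.sum_univ_three] at hg2
    have h0 := hr 0
    have h1 := hr 1
    have h2 := hr 2
    have g0 := hg 0
    have g1 := hg 1
    have g2 := hg 2
    by_cases c0 : r 1 + r 2 ≤ r 0
    · exact ⟨0, r 2, r 1, r 0 - r 1 - r 2, 0, 0, by linarith, by linarith, by linarith,
        by linarith, by linarith, by linarith, by linarith, by linarith, by linarith, by linarith⟩
    by_cases c1 : r 0 + r 2 ≤ r 1
    · exact ⟨r 2, 0, r 0, 0, r 1 - r 0 - r 2, 0, by linarith, by linarith, by linarith,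
        by linarith, by linarith, by linarith, by linarith, by linarith, by linarith, by linarith⟩
    by_cases c2 : r 0 + r 1 ≤ r 2
    · exact ⟨r 1, r 0, 0, 0, 0, r 2 - r 0 - r 1, by linarith, by linarith, by linarith,
        by linarith, by linarith, by linarith, by linarith, by linarith, by linarith, by linarith⟩
    · exact ⟨(r 1 + r 2 - r 0) / 2, (r 0 + r 2 - r 1) / 2, (r 0 + r 1 - r 2) / 2, 0, 0, 0,
        by linarith, by linarith, by linarith, by linarith, by linarith, by linarith, by linarith,
        by linarith, by linarith, by linarith⟩
  obtain ⟨a, b, c, x, y, z, ha, hb, hc, hx, hy, hz, h0, h1, h2, h3⟩ := key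
  refine ⟨![![x, c, b], ![c, y, a], ![b, a, z]], fun i j => ?_, fun i j => ?_, fun i => ?_, ?_⟩
  · fin_cases i <;> fin_cases j <;> simpa
  · fin_cases i <;> fin_cases j <;> rfl
  · fin_cases i <;> simp [Fin.sum_univ_three] <;> linarith
  · have := mul_le_mul_of_nonneg_left h3 pi_pos.le
    simp [Fin.sum_univ_three]
    linarith

variable [Fintype T]

/-- Nonnegative multiplicities of turns between the sides of each triangle such that every edge is
approached equally often from both sides. -/
structure IsTurning (K : TriangleGluing T) (A : T × Fin 3 → T × Fin 3 → ℝ) : Prop where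
  nonneg : ∀ d d', 0 ≤ A d d'
  symm : ∀ d d', A d d' = A d' d
  fst_eq : ∀ d d', A d d' ≠ 0 → d.1 = d'.1
  sum_glue : ∀ d, ∑ d', A (K.glue d) d' = ∑ d', A d d'

variable (K) in
/-- The total slack of the bounds on the turns `A` with respect to the edge data `p`. -/
def slack (p : K.Edge → ℝ) (A : T × Fin 3 → T × Fin 3 → ℝ) : ℝ :=
  ∑ d, ∑ d', A d d' * (turnBound d d' - K.theta p (K.edge d))

open Classical in
lemma sum_turn (a b d : T × Fin 3) :
    ∑ d', turn a b d d' = (if d = a then 1 else 0) + if d = b then 1 else 0 := by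
  simp [turn, Finset.sum_add_distrib, ite_and]

lemma sum_sum_turn_mul (a b : T × Fin 3) (F : T × Fin 3 → T × Fin 3 → ℝ) :
    ∑ d, ∑ d', turn a b d d' * F d d' = F a b + F b a := by
  classical
  simp [turn, add_mul, Finset.sum_add_distrib, ite_and, ite_mul]

lemma sum_sum_walkTurns_mul (n : ℕ) (s : ℕ → T × Fin 3) (F : T × Fin 3 → T × Fin 3 → ℝ) :
    ∑ d, ∑ d', K.walkTurns n s d d' * F d d' =
      ∑ i ∈ Finset.range n, (F (s i) (K.glue (s (i + 1))) + F (K.glue (s (i + 1))) (s i)) := by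
  simp only [walkTurns, Finset.sum_mul, ← sum_sum_turn_mul]
  rw [Finset.sum_comm]
  simp only [Finset.sum_comm (s := Finset.range n)]
  exact Finset.sum_comm

open Classical in
lemma sum_walkTurns (n : ℕ) (s : ℕ → T × Fin 3) (d : T × Fin 3) :
    ∑ d', K.walkTurns n s d d' = (∑ i ∈ Finset.range n, if d = s i then (1 : ℝ) else 0) +
      ∑ i ∈ Finset.range n, if d = K.glue (s (i + 1)) then (1 : ℝ) else 0 := by
  simp only [walkTurns]
  rw [Finset.sum_comm, ← Finset.sum_add_distrib]
  simp only [sum_turn]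

lemma slack_walkTurns (p : K.Edge → ℝ) {n : ℕ} {s : ℕ → T × Fin 3} (hs : K.IsSnake n s) :
    K.slack p (K.walkTurns n s) = ∑ i ∈ Finset.range n,
      (2 * π - K.theta p (K.edge (s i)) - K.theta p (K.edge (s (i + 1)))) := by
  rw [slack, sum_sum_walkTurns_mul]
  refine Finset.sum_congr rfl fun i hi => ?_
  have := (hs i (Finset.mem_range.1 hi)).2
  rw [turnBound, turnBound, if_neg this, if_neg this.symm, edge_glue]
  ring

lemma slack_add (p : K.Edge → ℝ) (A B : T × Fin 3 → T × Fin 3 → ℝ) :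
    K.slack p (fun d d' => A d d' + B d d') = K.slack p A + K.slack p B := by
  simp only [slack, ← Finset.sum_add_distrib, add_mul]

lemma slack_smul (p : K.Edge → ℝ) (c : ℝ) (A : T × Fin 3 → T × Fin 3 → ℝ) :
    K.slack p (fun d d' => c * A d d') = c * K.slack p A := by
  simp only [slack, Finset.mul_sum, mul_assoc]

lemma slack_turn_self (p : K.Edge → ℝ) (a : T × Fin 3) :
    K.slack p (turn a a) = 2 * (2 * π - K.theta p (K.edge a)) := by
  rw [slack, sum_sum_turn_mul, turnBound, if_pos rfl]
  ring

/-- The turns of a closed walk balance at every edge, and their slack is twice the gap in (n₃). -/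
lemma HasLoop.exists_isTurning {R : T × Fin 3 → T × Fin 3 → Prop} (hR : K.IsTransition R)
    (h : HasLoop K R) {p : K.Edge → ℝ} (hp : K.CondLoop p) :
    ∃ B, K.IsTurning B ∧ (∀ d d', B d d' ≠ 0 → R d d') ∧ (∃ d d', 0 < B d d') ∧
      0 < K.slack p B := by
  classical
  obtain ⟨n, s, hs, hf⟩ := h
  obtain ⟨hs', hn, hns⟩ : K.IsLoop n s := hs.elim (fun h => h.1) fun h => h.1
  have hlt := hp n s hs
  have hshift : ∀ f : T × Fin 3 → ℝ,
      ∑ i ∈ Finset.range n, f (s (i + 1)) = ∑ i ∈ Finset.range n, f (s i) := by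
    intro f
    have := Finset.sum_range_succ (fun i => f (s i)) n
    rw [Finset.sum_range_succ', hns] at this
    exact add_right_cancel this
  refine ⟨K.walkTurns n s, ⟨K.walkTurns_nonneg n s, fun d d' => ?_, fun d d' h => ?_, fun d => ?_⟩,
    fun d d' h => hf.of_walkTurns_ne_zero hR h, ⟨s 0, K.glue (s 1), ?_⟩, ?_⟩
  · exact Finset.sum_congr rfl fun i _ => turn_symm _ _ _ _
  · exact hR.fst_eq (hf.of_walkTurns_ne_zero hR h)
  · rw [sum_walkTurns, sum_walkTurns, hshift fun x => if K.glue d = K.glue x then (1 : ℝ) else 0,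
      hshift fun x => if d = K.glue x then (1 : ℝ) else 0, sum_crossings_glue]
  · exact Finset.sum_pos' (fun i _ => turn_nonneg _ _ _ _)
      ⟨0, Finset.mem_range.2 hn, turn_self_pos _ _⟩
  · rw [slack_walkTurns p hs', Finset.sum_sub_distrib, Finset.sum_sub_distrib,
      hshift fun x => K.theta p (K.edge x)]
    simp
    linarith

lemma HasSnake.exists_isTurning {R : T × Fin 3 → T × Fin 3 → Prop} (hR : K.IsTransition R)
    (h : HasSnake K R) {p : K.Edge → ℝ} (hp : K.CondSnake p) :
    ∃ B, K.IsTurning B ∧ (∀ d d', B d d' ≠ 0 → R d d') ∧ (∃ d d', 0 < B d d') ∧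
      0 < K.slack p B := by
  classical
  obtain ⟨n, s, hs, hf, h0, hn⟩ := h
  have hs' : K.IsSnake n s := hs.elim (fun h => h.1) fun h => h.1
  have hlt := hp n s hs
  -- The end turns restore the balance at the first and last edges and make the slack twice the gap
  -- in (n₄). The factor `1 / 2` is there because `turn a a a a = 2`.
  let B : T × Fin 3 → T × Fin 3 → ℝ := fun d d' => K.walkTurns n s d d' +
    1 / 2 * (turn (K.glue (s 0)) (K.glue (s 0)) d d' + turn (s n) (s n) d d')
  have hsupp : ∀ d d', B d d' ≠ 0 → R d d' := by
    intro d d' h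
    by_contra hRd
    have h1 : K.walkTurns n s d d' = 0 :=
      not_ne_iff.1 fun h => hRd (hf.of_walkTurns_ne_zero hR h)
    have h2 : turn (K.glue (s 0)) (K.glue (s 0)) d d' = 0 := not_ne_iff.1 fun h => hRd <| by
      rcases eq_or_eq_of_turn_ne_zero h with ⟨rfl, rfl⟩ | ⟨rfl, rfl⟩ <;> exact h0
    have h3 : turn (s n) (s n) d d' = 0 := not_ne_iff.1 fun h => hRd <| by
      rcases eq_or_eq_of_turn_ne_zero h with ⟨rfl, rfl⟩ | ⟨rfl, rfl⟩ <;> exact hn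
    simp [B, h1, h2, h3] at h
  have hnn : ∀ d d', 0 ≤ B d d' := fun d d' => by
    have h1 := K.walkTurns_nonneg n s d d'
    have h2 := turn_nonneg (K.glue (s 0)) (K.glue (s 0)) d d'
    have h3 := turn_nonneg (s n) (s n) d d'
    positivity
  refine ⟨B, ⟨hnn, fun d d' => ?_, fun d d' h => hR.fst_eq (hsupp d d' h), fun d => ?_⟩, hsupp,
    ⟨s n, s n, ?_⟩, ?_⟩
  · simp only [B]
    rw [turn_symm _ _ d d', turn_symm (s n) _ d d']
    congr 1
    exact Finset.sum_congr rfl fun i _ => turn_symm _ _ _ _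
  · have hrow : ∀ d, ∑ d', B d d' = (∑ i ∈ Finset.range (n + 1), if d = s i then (1 : ℝ) else 0) +
        ∑ i ∈ Finset.range (n + 1), if d = K.glue (s i) then (1 : ℝ) else 0 := by
      intro d
      simp only [B]
      rw [Finset.sum_add_distrib, ← Finset.mul_sum, Finset.sum_add_distrib, sum_turn, sum_turn,
        sum_walkTurns, Finset.sum_range_succ,
        Finset.sum_range_succ' fun i => if d = K.glue (s i) then (1 : ℝ) else 0]
      ring
    rw [hrow, hrow, sum_crossings_glue]
  · have h1 := K.walkTurns_nonneg n s (s n) (s n)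
    have h2 := turn_nonneg (K.glue (s 0)) (K.glue (s 0)) (s n) (s n)
    have h3 := turn_self_pos (s n) (s n)
    positivity
  · simp only [B]
    rw [slack_add, slack_smul, slack_add, slack_turn_self, slack_turn_self, slack_walkTurns p hs',
      Finset.sum_sub_distrib, Finset.sum_sub_distrib, edge_glue]
    have h1 := Finset.sum_range_succ (fun i => K.theta p (K.edge (s i))) n
    have h2 := Finset.sum_range_succ' (fun i => K.theta p (K.edge (s i))) n
    simp
    linarith

lemma IsTurning.isTransition {A : T × Fin 3 → T × Fin 3 → ℝ} (hA : K.IsTurning A) :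
    K.IsTransition fun d d' => 0 < A d d' where
  symm {d d'} h := by rwa [hA.symm]
  fst_eq {d d'} h := hA.fst_eq d d' h.ne'
  glue {d d'} h := by
    have h1 : 0 < ∑ d'', A (K.glue d) d'' := by
      rw [hA.sum_glue]
      exact Finset.sum_pos' (fun _ _ => hA.nonneg _ _) ⟨d', Finset.mem_univ _, h⟩
    obtain ⟨d'', -, h2⟩ := Finset.exists_ne_zero_of_sum_ne_zero h1.ne'
    exact ⟨d'', (hA.nonneg _ _).lt_of_ne' h2⟩

/-- Induction on the support, as in the decomposition of a flow into cycles: a loop or snake inside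
the support has positive slack, and subtracting as much of it as nonnegativity permits kills an
entry. -/
lemma IsTurning.slack_pos {p : K.Edge → ℝ} (hl : K.CondLoop p) (hs : K.CondSnake p)
    {A : T × Fin 3 → T × Fin 3 → ℝ} (hA : K.IsTurning A) {x x' : T × Fin 3} (hx : A x x' ≠ 0) :
    0 < K.slack p A := by
  classical
  induction h : (Finset.univ.filter fun q : (T × Fin 3) × (T × Fin 3) => A q.1 q.2 ≠ 0).card
    using Nat.strong_induction_on generalizing A x x' with
  | _ k ih =>
    obtain ⟨B, hB, hBA, ⟨y, y', hy⟩, hpos⟩ : ∃ B, K.IsTurning B ∧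
        (∀ d d', B d d' ≠ 0 → 0 < A d d') ∧ (∃ d d', 0 < B d d') ∧ 0 < K.slack p B := by
      rcases hA.isTransition.hasLoop_or_hasSnake ((hA.nonneg x x').lt_of_ne' hx) with h | h
      · exact HasLoop.exists_isTurning hA.isTransition h hl
      · exact HasSnake.exists_isTurning hA.isTransition h hs
    obtain ⟨⟨z, z'⟩, hz, hmin⟩ := Finset.exists_min_image
      (Finset.univ.filter fun q : (T × Fin 3) × (T × Fin 3) => B q.1 q.2 ≠ 0)
      (fun q => A q.1 q.2 / B q.1 q.2) ⟨(y, y'), by simpa using hy.ne'⟩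
    simp only [Finset.mem_filter, Finset.mem_univ, true_and] at hz hmin
    have hBz : 0 < B z z' := (hB.nonneg z z').lt_of_ne' hz
    have hAz : 0 < A z z' := hBA z z' hz
    set τ := A z z' / B z z' with hτ
    have hτ0 : 0 < τ := by positivity
    have hA' : K.IsTurning fun d d' => A d d' + -τ * B d d' := by
      refine ⟨fun d d' => ?_, fun d d' => ?_, fun d d' h => ?_, fun d => ?_⟩
      · by_cases h0 : B d d' = 0
        · simpa [h0] using hA.nonneg d d'
        · have hBd : 0 < B d d' := (hB.nonneg d d').lt_of_ne' h0
          have := (le_div_iff₀ hBd).1 (hmin (d, d') h0)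
          linarith
      · rw [hA.symm, hB.symm]
      · by_cases h0 : A d d' = 0
        · have : B d d' = 0 := not_ne_iff.1 fun h => (hBA d d' h).ne' h0
          simp [h0, this] at h
        · exact hA.fst_eq d d' h0
      · simp only [Finset.sum_add_distrib, ← Finset.mul_sum, hA.sum_glue, hB.sum_glue]
    have hsplit : K.slack p A = K.slack p (fun d d' => A d d' + -τ * B d d') + τ * K.slack p B := by
      rw [slack_add, slack_smul]
      ring
    have hnonneg : 0 ≤ K.slack p fun d d' => A d d' + -τ * B d d' := by
      by_cases h0 : ∃ d d', A d d' + -τ * B d d' ≠ 0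
      · obtain ⟨d, d', h0⟩ := h0
        refine (ih _ ?_ hA' h0 rfl).le
        rw [← h]
        refine Finset.card_lt_card ⟨fun q hq => ?_, fun hsub => ?_⟩
        · simp only [Finset.mem_filter, Finset.mem_univ, true_and] at hq ⊢
          intro hAq
          have : B q.1 q.2 = 0 := not_ne_iff.1 fun h => (hBA _ _ h).ne' hAq
          simp [hAq, this] at hq
        · have := hsub (Finset.mem_filter.2 ⟨Finset.mem_univ (z, z'), hAz.ne'⟩)
          simp only [Finset.mem_filter, Finset.mem_univ, true_and] at this
          apply this
          rw [hτ]
          field_simp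
          ring
      · push Not at h0
        simp only [slack, h0, zero_mul, Finset.sum_const_zero, le_refl]
    rw [hsplit]
    positivity

/-- The weights are realised as row sums of a turning; its cost in each triangle is at most `2 * π *
g`, and its slack is positive. -/
lemma sum_mul_theta_lt {p : K.Edge → ℝ} (hl : K.CondLoop p) (hs : K.CondSnake p)
    {r : T × Fin 3 → ℝ} (hr : ∀ d, 0 ≤ r d) (hrg : ∀ d, r (K.glue d) = r d)
    {x : T × Fin 3} (hx : r x ≠ 0) {g : T → ℝ} (hg : ∀ d, r d ≤ g d.1)
    (hg2 : ∀ t, ∑ i, r (t, i) ≤ 2 * g t) :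
    ∑ d, r d * K.theta p (K.edge d) < 2 * π * ∑ t, g t := by
  classical
  choose M hM0 hMs hMr hMc using fun t => exists_turn_matrix (fun i => r (t, i))
    (fun i => hr (t, i)) (g t) (fun i => hg (t, i)) (hg2 t)
  let A : T × Fin 3 → T × Fin 3 → ℝ := fun d d' => if d.1 = d'.1 then M d.1 d.2 d'.2 else 0
  have hrow : ∀ d, ∑ d', A d d' = r d := by
    rintro ⟨t, i⟩
    rw [Fintype.sum_prod_type]
    simp only [A]
    rw [Finset.sum_eq_single t (fun t' _ h => by simp [h.symm]) (by simp)]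
    simpa using hMr t i
  have hA : K.IsTurning A := by
    refine ⟨fun d d' => ?_, fun d d' => ?_, fun d d' h => ?_, fun d => ?_⟩
    · simp only [A]
      split_ifs
      exacts [hM0 _ _ _, le_rfl]
    · obtain ⟨t, i⟩ := d
      obtain ⟨t', j⟩ := d'
      by_cases h : t = t'
      · subst h
        simpa [A] using hMs t i j
      · simp [A, h, Ne.symm h]
    · by_contra h'
      simp [A, h'] at h
    · rw [hrow, hrow, hrg]
  obtain ⟨x', -, hx'⟩ := Finset.exists_ne_zero_of_sum_ne_zero (hrow x ▸ hx)
  have hpos := hA.slack_pos hl hs hx'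
  have hsl : K.slack p A = ∑ d, ∑ d', A d d' * turnBound d d' -
      ∑ d, r d * K.theta p (K.edge d) := by
    simp only [slack, mul_sub, Finset.sum_sub_distrib, ← Finset.sum_mul, hrow]
  have hle : ∑ d, ∑ d', A d d' * turnBound d d' ≤ 2 * π * ∑ t, g t := by
    rw [Fintype.sum_prod_type, Finset.mul_sum]
    refine Finset.sum_le_sum fun t _ => (hMc t).trans' (le_of_eq ?_)
    refine Finset.sum_congr rfl fun i _ => ?_
    rw [Fintype.sum_prod_type, Finset.sum_eq_single t (fun t' _ h => by simp [A, h.symm]) (by simp)]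
    simp [A, turnBound]
  linarith

end TriangleGluing

/-! ### Layers governed by the condition on sets of triangles -/

namespace TriangleGluing

variable {T : Type*} [Fintype T] {K : TriangleGluing T}

/-- A single layer: (n₂) doubled because each edge has two sides, with the remaining sides in `Q`
only adding to the sum. For empty `S` the positivity of `θ` is enough. -/
lemma CondSet.lt_sum_sides {p : K.Edge → ℝ} (hp : K.CondSet p) (hθ : ∀ e, 0 < K.theta p e)
    (S : Finset T) {Q : T × Fin 3 → Prop} [DecidablePred Q] (hQ : ∀ d, Q (K.glue d) → Q d)
    (hS : ∀ d, d.1 ∈ S → Q d) {x : T × Fin 3} (hx : Q x) :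
    2 * π * S.card < ∑ d, if Q d then K.theta p (K.edge d) else 0 := by
  classical
  rcases S.eq_empty_or_nonempty with rfl | hne
  · simp only [Finset.card_empty, Nat.cast_zero, mul_zero]
    refine Finset.sum_pos' (fun d _ => ?_) ⟨x, Finset.mem_univ _, ?_⟩
    · split_ifs
      exacts [(hθ _).le, le_rfl]
    · rw [if_pos hx]
      exact hθ _
  · have h1 := hp S hne
    have h2 := K.sum_comp_edge fun e => if e ∈ K.edgesOf S then K.theta p e else 0
    rw [Finset.sum_ite_mem, Finset.univ_inter] at h2
    have h3 : ∑ d, (if K.edge d ∈ K.edgesOf S then K.theta p (K.edge d) else 0) ≤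
        ∑ d, if Q d then K.theta p (K.edge d) else 0 := by
      refine Finset.sum_le_sum fun d _ => ?_
      have := (hθ (K.edge d)).le
      by_cases hd : K.edge d ∈ K.edgesOf S
      · have hQd : Q d := by
          simp only [edgesOf, Finset.mem_filter, Finset.mem_univ, true_and] at hd
          obtain ⟨d', hd', he⟩ := hd
          rcases K.edge_eq_iff.1 he with rfl | rfl
          · exact hS _ hd'
          · exact hQ _ (by rw [glue_glue]; exact hS _ hd')
        rw [if_pos hd, if_pos hQd]
      · rw [if_neg hd]
        split_ifs
        exacts [this, le_rfl]
    linarith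

lemma CondSet.sum_lt {p : K.Edge → ℝ} (hp : K.CondSet p) (hθ : ∀ e, 0 < K.theta p e)
    {r : T × Fin 3 → ℝ} (hr : ∀ d, 0 ≤ r d) (hrg : ∀ d, r (K.glue d) = r d)
    {x : T × Fin 3} (hx : r x ≠ 0) {m : T → ℝ} (hm : ∀ d : T × Fin 3, m d.1 ≤ r d) :
    2 * π * ∑ t, m t < ∑ d, r d * K.theta p (K.edge d) := by
  classical
  induction h : (Finset.univ.filter fun d => r d ≠ 0).card
    using Nat.strong_induction_on generalizing r m x with
  | _ k ih =>
    obtain ⟨z, hz, hmin⟩ := Finset.exists_min_image (Finset.univ.filter fun d => r d ≠ 0) r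
      ⟨x, by simpa using hx⟩
    simp only [Finset.mem_filter, Finset.mem_univ, true_and] at hz hmin
    have hτ0 : 0 < r z := (hr z).lt_of_ne' hz
    set τ := r z with hτ
    -- One layer of height `τ`, the least nonzero value of `r`, is removed. Off `S` some side has `r
    -- = 0`, so `m ≤ 0` there already and need not be lowered.
    let S : Finset T := Finset.univ.filter fun t => ∀ i, r (t, i) ≠ 0
    have hS : ∀ d : T × Fin 3, d.1 ∈ S → r d ≠ 0 := fun d hd => (Finset.mem_filter.1 hd).2 d.2
    have hstep := hp.lt_sum_sides hθ S (Q := fun d => r d ≠ 0) (fun d hd => hrg d ▸ hd) hS hx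
    let r' : T × Fin 3 → ℝ := fun d => r d - τ * if r d ≠ 0 then 1 else 0
    let m' : T → ℝ := fun t => m t - τ * if t ∈ S then 1 else 0
    have hr'0 : ∀ d, 0 ≤ r' d := by
      intro d
      by_cases hd : r d ≠ 0
      · simp only [r', if_pos hd]
        linarith [hmin d hd]
      · simp only [r', if_neg hd]
        linarith [hr d]
    have hr'g : ∀ d, r' (K.glue d) = r' d := fun d => by simp only [r', hrg]
    have hm' : ∀ d : T × Fin 3, m' d.1 ≤ r' d := by
      intro d
      by_cases hd : d.1 ∈ S
      · simp only [r', m', if_pos hd, if_pos (hS d hd)]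
        linarith [hm d]
      · have : ∃ i, r (d.1, i) = 0 := by simpa [S] using hd
        obtain ⟨i, hi⟩ := this
        have h1 := hm (d.1, i)
        have h2 := hr'0 d
        simp only [m', if_neg hd]
        linarith
    have hle : 2 * π * ∑ t, m' t ≤ ∑ d, r' d * K.theta p (K.edge d) := by
      by_cases h0 : ∃ d, r' d ≠ 0
      · obtain ⟨d, hd⟩ := h0
        refine (ih _ ?_ hr'0 hr'g hd hm' rfl).le
        rw [← h]
        refine Finset.card_lt_card ⟨fun q hq => ?_, fun hsub => ?_⟩
        · simp only [Finset.mem_filter, Finset.mem_univ, true_and] at hq ⊢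
          intro hrq
          simp [r', hrq] at hq
        · have := hsub (Finset.mem_filter.2 ⟨Finset.mem_univ z, hz⟩)
          simp only [Finset.mem_filter, Finset.mem_univ, true_and] at this
          apply this
          simp only [r', ← hτ, if_pos hz]
          ring
      · push Not at h0
        simp only [h0, zero_mul, Finset.sum_const_zero]
        refine mul_nonpos_of_nonneg_of_nonpos (by positivity) (Finset.sum_nonpos fun t _ => ?_)
        have := hm' (t, 0)
        rwa [h0] at this
    have e1 : ∑ t, m' t = ∑ t, m t - τ * S.card := by
      simp [m', Finset.sum_sub_distrib, ← Finset.mul_sum, -mul_ite]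
    have e2 : ∑ d, r' d * K.theta p (K.edge d) = ∑ d, r d * K.theta p (K.edge d) -
        τ * ∑ d, if r d ≠ 0 then K.theta p (K.edge d) else 0 := by
      simp only [r', sub_mul, Finset.sum_sub_distrib, Finset.mul_sum]
      congr 1
      refine Finset.sum_congr rfl fun d _ => ?_
      split_ifs <;> ring
    have := mul_lt_mul_of_pos_left hstep hτ0
    rw [e1, e2] at hle
    linarith

end TriangleGluing

/-! ### Separation of admissible weights from splittings -/

namespace TriangleGluing

variable {T : Type*}

lemma convex_isAdmissible : Convex ℝ {w : T × Fin 3 → ℝ | IsAdmissible w} := by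
  intro w hw w' hw' a b ha hb hab
  have key : ∀ x y, x < π → y < π → a * x + b * y < π := by
    intro x y hx hy
    have hx' := mul_le_mul_of_nonneg_left hx.le ha
    have hy' := mul_le_mul_of_nonneg_left hy.le hb
    have hπ : a * π + b * π = π := by rw [← add_mul, hab, one_mul]
    rcases ha.eq_or_lt with rfl | ha0
    · have hb1 : b = 1 := by linarith
      subst hb1
      linarith
    · have := mul_lt_mul_of_pos_left hx ha0
      linarith
  refine ⟨fun t => ?_, fun t i j hij => ?_⟩
  · have h1 := hw.1 t
    have h2 := hw'.1 t
    have := key (2 * π - ∑ i, w (t, i)) (2 * π - ∑ i, w' (t, i)) (by linarith) (by linarith)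
    have hπ : a * π + b * π = π := by rw [← add_mul, hab, one_mul]
    simp only [Pi.add_apply, Pi.smul_apply, smul_eq_mul, Finset.sum_add_distrib, ← Finset.mul_sum]
    linarith
  · have := key _ _ (hw.2 t i j hij) (hw'.2 t i j hij)
    simp only [Pi.add_apply, Pi.smul_apply, smul_eq_mul]
    linarith

lemma isOpen_isAdmissible [Finite T] : IsOpen {w : T × Fin 3 → ℝ | IsAdmissible w} := by
  have h : {w : T × Fin 3 → ℝ | IsAdmissible w} = (⋂ t, {w | π < ∑ i, w (t, i)}) ∩
      ⋂ t, ⋂ i, ⋂ j, ⋂ (_ : i ≠ j), {w | w (t, i) + w (t, j) < π} := by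
    ext w
    simp [IsAdmissible]
  rw [h]
  refine (isOpen_iInter_of_finite fun t => isOpen_lt (by fun_prop) (by fun_prop)).inter ?_
  refine isOpen_iInter_of_finite fun t => isOpen_iInter_of_finite fun i =>
    isOpen_iInter_of_finite fun j => isOpen_iInter_of_finite fun _ => ?_
  exact isOpen_lt (by fun_prop) (by fun_prop)

/-- An interior point towards which boundary weights are pushed; any constant strictly between `π/3`
and `π/2` would serve. -/
lemma isAdmissible_const : IsAdmissible fun _ : T × Fin 3 => 2 * π / 5 := by
  have := pi_pos
  refine ⟨fun t => ?_, fun t i j _ => ?_⟩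
  · simp
    linarith
  · linarith

lemma IsAdmissible.interpolate {w w' : T × Fin 3 → ℝ} (hw : IsAdmissible w)
    (h1 : ∀ t, π ≤ ∑ i, w' (t, i)) (h2 : ∀ t i j, i ≠ j → w' (t, i) + w' (t, j) ≤ π)
    {ε : ℝ} (h0 : 0 < ε) (h3 : ε ≤ 1) : IsAdmissible ((1 - ε) • w' + ε • w) := by
  have h4 : 0 ≤ 1 - ε := by linarith
  refine ⟨fun t => ?_, fun t i j hij => ?_⟩
  · have e1 := mul_le_mul_of_nonneg_left (h1 t) h4
    have e2 := mul_lt_mul_of_pos_left (hw.1 t) h0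
    simp only [Pi.add_apply, Pi.smul_apply, smul_eq_mul, Finset.sum_add_distrib, ← Finset.mul_sum]
    linarith
  · have e1 := mul_le_mul_of_nonneg_left (h2 t i j hij) h4
    have e2 := mul_lt_mul_of_pos_left (hw.2 t i j hij) h0
    simp only [Pi.add_apply, Pi.smul_apply, smul_eq_mul]
    linarith

/-- On the closed tetrahedron of weights of a triangle, a linear functional with coefficients `c`
attains at least the value `π (g - m)`, where `g` dominates the positive part of `c` and `m` is
dominated by the negative part. -/
lemma exists_triangle_weights (c : Fin 3 → ℝ) :
    ∃ (w : Fin 3 → ℝ) (m g : ℝ), π ≤ ∑ i, w i ∧ (∀ i j, i ≠ j → w i + w j ≤ π) ∧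
      (∀ i, m ≤ max (-c i) 0) ∧ (∀ i, max (c i) 0 ≤ g) ∧ ∑ i, max (c i) 0 ≤ 2 * g ∧
      π * (g - m) ≤ ∑ i, w i * c i := by
  classical
  have hπ := pi_pos
  obtain ⟨k, hk⟩ := Finite.exists_max c
  -- The vertices of the tetrahedron are `π` on a single side and `π/2` on all sides. The second is
  -- needed only when all `c i` are positive, with `g` half their sum and `m = 0`.
  by_cases h : ∑ i, max (c i) 0 ≤ 2 * max (c k) 0
  · refine ⟨Pi.single k π, max (-c k) 0, max (c k) 0, ?_, fun i j hij => ?_, fun i => ?_,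
      fun i => ?_, h, ?_⟩
    · simp
    · by_cases hi : i = k
      · subst hi
        simp [hij.symm]
      · by_cases hj : j = k <;> simp [hi, hj, hπ.le]
    · exact max_le_max_right _ (neg_le_neg (hk i))
    · exact max_le_max_right _ (hk i)
    · have : max (c k) 0 - max (-c k) 0 = c k := by
        rcases le_total (c k) 0 with h | h <;> simp [h]
      simp [this, Pi.single_apply]
  · have hpos : ∀ i, 0 < c i := by
      by_contra! hn
      obtain ⟨j, hj⟩ := hn
      apply h
      have hk' : ∀ i, max (c i) 0 ≤ max (c k) 0 := fun i => max_le_max_right _ (hk i)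
      have hj' : max (c j) 0 = 0 := max_eq_right hj
      rw [Fin.sum_univ_three]
      have h0 := hk' 0
      have h1 := hk' 1
      have h2 := hk' 2
      fin_cases j <;> simp only [Fin.zero_eta, Fin.mk_one, Fin.reduceFinMk] at hj' <;> linarith
    have hmax : ∀ i, max (c i) 0 = c i := fun i => max_eq_left (hpos i).le
    simp only [hmax] at h ⊢
    refine ⟨fun _ => π / 2, 0, (∑ i, c i) / 2, ?_, fun i j _ => by linarith,
      fun i => le_max_right _ _, fun i => ?_, by linarith, ?_⟩
    · simp
      linarith
    · have := hk i
      linarith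
    · rw [← Finset.mul_sum]
      linarith

variable [Fintype T] {K : TriangleGluing T}

lemma exists_isSplitting {p : K.Edge → ℝ} (hp : ∀ e, p e ∈ Set.Ioo (-π) π)
    (h2 : K.CondSet p) (h3 : K.CondLoop p) (h4 : K.CondSnake p) :
    ∃ w, IsAdmissible w ∧ K.IsSplitting p w := by
  classical
  by_contra! hno
  have hθ : ∀ e, 0 < K.theta p e := fun e => sub_pos.2 (hp e).2
  have hconv : Convex ℝ {w | K.IsSplitting p w} := by
    intro w hw w' hw' a b _ _ hab d
    have h := hw d
    have h' := hw' d
    simp only [Pi.add_apply, Pi.smul_apply, smul_eq_mul]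
    calc _ = a * (w d + w (K.glue d)) + b * (w' d + w' (K.glue d)) := by ring
      _ = (a + b) * K.theta p (K.edge d) := by rw [h, h']; ring
      _ = _ := by rw [hab, one_mul]
  obtain ⟨f, u, hfu, huf⟩ := geometric_hahn_banach_open convex_isAdmissible isOpen_isAdmissible
    hconv (Set.disjoint_left.2 fun w hw hw' => hno w hw hw')
  simp only [Set.mem_ofPred_eq] at hfu huf
  let c : T × Fin 3 → ℝ := fun d => f (Pi.single d 1)
  have hf : ∀ w, f w = ∑ d, w d * c d := by
    intro w
    conv_lhs => rw [← Finset.univ_sum_single w, map_sum]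
    refine Finset.sum_congr rfl fun d _ => ?_
    rw [← smul_eq_mul, ← map_smul, ← Pi.single_smul, smul_eq_mul, mul_one]
  let b : T × Fin 3 → ℝ := fun d => K.theta p (K.edge d) / 2
  have hb : K.IsSplitting p b := fun d => by simp [b]
  -- Transferring weight between glued sides preserves splittings, and a functional bounded below
  -- along a whole line is constant on it. The parameter chosen would give the value `u - 1`.
  have hcg : ∀ d, c (K.glue d) = c d := by
    intro d
    by_contra hne
    have hne' : c d - c (K.glue d) ≠ 0 := sub_ne_zero.2 (Ne.symm hne)
    have hspl : ∀ r : ℝ, K.IsSplitting p (b + r • (Pi.single d 1 - Pi.single (K.glue d) 1)) := by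
      intro r d'
      have h := hb d'
      simp only [Pi.add_apply, Pi.smul_apply, Pi.sub_apply, smul_eq_mul, Pi.single_apply,
        K.glue_eq_iff, K.glue_glue]
      linarith
    have h := huf _ (hspl ((u - f b - 1) / (c d - c (K.glue d))))
    rw [map_add, map_smul, map_sub, smul_eq_mul] at h
    change u ≤ f b + (u - f b - 1) / (c d - c (K.glue d)) * (c d - c (K.glue d)) at h
    rw [div_mul_cancel₀ _ hne'] at h
    linarith
  choose w m g hw1 hw2 hm hg hg2 hwc using fun t => exists_triangle_weights fun i => c (t, i)
  -- The bound passes to the closure: otherwise a point of the segment towards an admissible weight,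
  -- itself admissible, would have value exactly `u`.
  have hfw : f (fun d => w d.1 d.2) ≤ u := by
    by_contra! hlt
    have h0 := hfu _ isAdmissible_const
    set x := f (fun d => w d.1 d.2)
    set y := f fun _ => 2 * π / 5
    have hxy : 0 < x - y := by linarith
    have h := hfu _ (isAdmissible_const.interpolate (w' := fun d => w d.1 d.2) hw1 hw2
      (ε := (x - u) / (x - y)) (div_pos (by linarith) hxy) ((div_le_one hxy).2 (by linarith)))
    rw [map_add, map_smul, map_smul, smul_eq_mul, smul_eq_mul] at h
    change (1 - (x - u) / (x - y)) * x + (x - u) / (x - y) * y < u at h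
    have h' : (1 - (x - u) / (x - y)) * x + (x - u) / (x - y) * y =
        x - (x - u) / (x - y) * (x - y) := by ring
    rw [h', div_mul_cancel₀ _ hxy.ne'] at h
    linarith
  have hlow : π * (∑ t, g t - ∑ t, m t) ≤ f (fun d => w d.1 d.2) := by
    rw [hf, Fintype.sum_prod_type, ← Finset.sum_sub_distrib, Finset.mul_sum]
    exact Finset.sum_le_sum fun t _ => hwc t
  have hfb : f b = (∑ d, max (c d) 0 * K.theta p (K.edge d) -
      ∑ d, max (-c d) 0 * K.theta p (K.edge d)) / 2 := by
    rw [hf, ← Finset.sum_sub_distrib, Finset.sum_div]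
    refine Finset.sum_congr rfl fun d _ => ?_
    rw [← sub_mul]
    have : max (c d) 0 - max (-c d) 0 = c d := by
      rcases le_total (c d) 0 with h | h <;> simp [h]
    rw [this]
    simp only [b]
    ring
  have hub := huf b hb
  have hpos : (∃ d, max (c d) 0 ≠ 0) →
      ∑ d, max (c d) 0 * K.theta p (K.edge d) < 2 * π * ∑ t, g t := fun ⟨d, hd⟩ =>
    sum_mul_theta_lt h3 h4 (fun d => le_max_right _ _) (fun d => by rw [hcg]) hd
      (fun d => hg d.1 d.2) hg2
  have hneg : (∃ d, max (-c d) 0 ≠ 0) →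
      2 * π * ∑ t, m t < ∑ d, max (-c d) 0 * K.theta p (K.edge d) := fun ⟨d, hd⟩ =>
    h2.sum_lt (r := fun d => max (-c d) 0) hθ (fun d => le_max_right _ _) (fun d => by simp only [hcg]) hd
      fun d => hm d.1 d.2
  have hpos' : ¬ (∃ d, max (c d) 0 ≠ 0) →
      ∑ d, max (c d) 0 * K.theta p (K.edge d) ≤ 2 * π * ∑ t, g t := by
    intro h
    push Not at h
    simp only [h, zero_mul, Finset.sum_const_zero]
    have : 0 ≤ ∑ t, g t := Finset.sum_nonneg fun t _ => (le_max_right _ _).trans (hg t 0)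
    positivity
  have hneg' : ¬ (∃ d, max (-c d) 0 ≠ 0) →
      2 * π * ∑ t, m t ≤ ∑ d, max (-c d) 0 * K.theta p (K.edge d) := by
    intro h
    push Not at h
    simp only [h, zero_mul, Finset.sum_const_zero]
    refine mul_nonpos_of_nonneg_of_nonpos (by positivity) (Finset.sum_nonpos fun t _ => ?_)
    exact (hm t 0).trans (h _).le
  -- The chain is `π (∑ g - ∑ m) ≤ u ≤ f b ≤ π (∑ g - ∑ m)`, its last inequality strict unless `c =
  -- 0`; then `f = 0`, against the strict separation at the constant weight.
  by_cases c1 : ∃ d, max (c d) 0 ≠ 0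
  · have l1 := hpos c1
    have l2 : 2 * π * ∑ t, m t ≤ ∑ d, max (-c d) 0 * K.theta p (K.edge d) := by
      by_cases c2 : ∃ d, max (-c d) 0 ≠ 0
      exacts [(hneg c2).le, hneg' c2]
    linarith
  · have l1 := hpos' c1
    by_cases c2 : ∃ d, max (-c d) 0 ≠ 0
    · have l2 := hneg c2
      linarith
    · push Not at c1 c2
      have hc : ∀ d, c d = 0 := fun d =>
        le_antisymm (by simpa using c1 d) (by simpa using c2 d)
      have h0 := hfu _ isAdmissible_const
      simp only [hf, hc, mul_zero, Finset.sum_const_zero] at h0 hub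
      linarith

end TriangleGluing

end

theorem mainTheorem3 {T : Type*} [Fintype T] (K : TriangleGluing T)
    (hconn : K.Connected) (hχ : K.eulerChar < 0) :
    K.Psi '' K.angleSystems = K.edgeData := by
  ext p
  rw [K.mem_image_Psi_iff]
  constructor
  · rintro ⟨h1, w, hw, hp⟩
    exact ⟨hp.mem_Ioo hw, h1, hp.condSet hw, hp.condLoop hw, hp.condSnake hw⟩
  · rintro ⟨h0, h1, h2, h3, h4⟩
    exact ⟨h1, TriangleGluing.exists_isSplitting h0 h2 h3 h4⟩
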